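/- Let $\mathcal K$ be a locally small category. An object is \emph{connected} if it is non-initial and is not a coproduct of two non-initial objects; it has \emph{power} $\kappa$ if it is a coproduct of $\kappa$ connected objects. $\mathcal K$ has \emph{width} $w(\mathcal K)$ if it has coproducts, every object is a coproduct of connected objects, and $w(\mathcal K)$ is the smallest cardinal such that (a) $\mathcal K$ has at most $w(\mathcal K)$ connected objects up to isomorphism, and (b) for every cardinal $\mu\ge w(\mathcal K)$ there are at most $\mu$ morphisms from a connected object to an object of power $\mu$. $\mathcal K$ has \emph{strict width} $w(\mathcal K)$ if, moreover, its coproduct injections are monic and every connected object is $(w(\mathcal K)+\aleph_0)$-presentable, where, for an infinite cardinal $\kappa$, an object $A$ is $\kappa$-presentable if $\mathcal K(A,-)$ preserves $\kappa$-filtered colimits. For an infinite regular cardinal $\alpha$, $\mathcal K$ is \emph{strictly locally $\alpha$-presentable} if it is locally $\alpha$-presentable and every morphism $b\colon B\to A$ with $B$ $\alpha$-presentable has a factorization $b=b'\cdot f\cdot b$ for some $f\colon A\to B'$ and $b'\colon B'\to A$ with $B'$ $\alpha$-presentable. Let $\mathcal K_{\le\lambda}$ denote the full subcategory of $\mathcal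 K$ on the objects of power at most $\lambda$ (that is, coproducts of at most $\lambda$ connected objects). \textbf{Theorem.} Let $\alpha$ be an infinite regular cardinal and let $\mathcal K$ be a strictly locally $\alpha$-presentable category with strict width $w(\mathcal K)$. Then for every cardinal $\lambda\ge\max(\alpha,w(\mathcal K))$ the category $\mathcal K_{\le\lambda}$ is algebraically complete, i.e. every endofunctor $F$ of $\mathcal K_{\le\lambda}$ has an initial algebra. -/

import Mathlib

open CategoryTheory CategoryTheory.Limits

universe v u

namespace StrictWidth

variable {K : Type u} [Category.{v} K]

/-- An object is connected if it is non-initial and is not a coproduct of two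
non-initial objects. -/
def IsConnectedObj (X : K) : Prop :=
  ¬ Nonempty (IsInitial X) ∧
    ∀ (A B : K) (i : A ⟶ X) (j : B ⟶ X), Nonempty (IsColimit (BinaryCofan.mk i j)) →
      Nonempty (IsInitial A) ∨ Nonempty (IsInitial B)

/-- `X` has power `κ` if it is a coproduct of `κ` connected objects. -/
def HasPower (X : K) (κ : Cardinal.{v}) : Prop :=
  ∃ (I : Type v) (Y : I → K) (inj : ∀ i, Y i ⟶ X),
    Cardinal.mk I = κ ∧ (∀ i, IsConnectedObj (Y i)) ∧ Nonempty (IsColimit (Cofan.mk X inj))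

/-- `X` has power at most `lam`. -/
def powerLE (K : Type u) [Category.{v} K] (lam : Cardinal.{v}) : ObjectProperty K :=
  fun X => ∃ κ : Cardinal.{v}, κ ≤ lam ∧ HasPower X κ

/-- The full subcategory of `K` on the objects of power at most `lam`. -/
abbrev PowerLE (K : Type u) [Category.{v} K] (lam : Cardinal.{v}) :=
  (powerLE K lam).FullSubcategory

/-- Condition (a): there are at most `κ` connected objects up to isomorphism. -/
def ConnectedObjectsLE (K : Type u) [Category.{v} K] (κ : Cardinal.{v}) : Prop :=
  ∃ (I : Type v) (R : I → K), Cardinal.mk I ≤ κ ∧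
    ∀ C : K, IsConnectedObj C → ∃ i, Nonempty (C ≅ R i)

/-- Condition (b): for every cardinal `μ ≥ κ` there are at most `μ` morphisms from a connected
object to an object of power `μ`. -/
def ConnectedHomsLE (K : Type u) [Category.{v} K] (κ : Cardinal.{v}) : Prop :=
  ∀ μ : Cardinal.{v}, κ ≤ μ → ∀ C X : K, IsConnectedObj C → HasPower X μ →
    Cardinal.mk (C ⟶ X) ≤ μ

/-- `K` has width `w`: it has (small) coproducts, every object is a coproduct of connected
objects, and `w` is the smallest cardinal satisfying conditions (a) and (b). -/
structure HasWidth (K : Type u) [Category.{v} K] (w : Cardinal.{v}) : Prop where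
  hasCoproducts : HasCoproducts.{v} K
  exists_power : ∀ X : K, ∃ κ : Cardinal.{v}, HasPower X κ
  isLeast : IsLeast {κ : Cardinal.{v} | ConnectedObjectsLE K κ ∧ ConnectedHomsLE K κ} w

/-- `κ`-filtered categories, for a not necessarily regular cardinal `κ`: every diagram with fewer
than `κ` morphisms has a cocone. (Mathlib's `IsCardinalFiltered` requires `κ` to be regular, and
is literally the same condition then.) -/
def IsFilteredFor (J : Type v) [SmallCategory J] (κ : Cardinal.{v}) : Prop :=
  ∀ (A : Type v) [SmallCategory A] (D : A ⥤ J), Cardinal.mk (Arrow A) < κ → Nonempty (Cocone D)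

/-- `κ`-presentable objects, for a not necessarily regular infinite cardinal `κ`: the hom-functor
`K(X, -)` preserves `κ`-filtered colimits. -/
def IsPresentableFor (X : K) (κ : Cardinal.{v}) : Prop :=
  ∀ (J : Type v) [SmallCategory J], IsFilteredFor J κ →
    PreservesColimitsOfShape J (coyoneda.obj (Opposite.op X))

/-- `K` has strict width `w`: it has width `w`, coproduct injections are monic, and every
connected object is `(w + ℵ₀)`-presentable. -/
structure HasStrictWidth (K : Type u) [Category.{v} K] (w : Cardinal.{v}) : Prop
    extends HasWidth K w where
  mono_inj : ∀ (I : Type v) (Y : I → K) (c : Cofan Y), IsColimit c → ∀ i, Mono (c.inj i)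
  presentable : ∀ C : K, IsConnectedObj C → IsPresentableFor C (w + Cardinal.aleph0)

/-- `K` is strictly locally `α`-presentable: it is locally `α`-presentable, and every morphism
`b : B ⟶ A` with `B` `α`-presentable factorizes as `b`, followed by some `f : A ⟶ B'`, followed
by some `b' : B' ⟶ A`, with `B'` also `α`-presentable. -/
structure IsStrictlyLocallyPresentable (K : Type u) [Category.{v} K] (α : Cardinal.{v})
    [Fact α.IsRegular] : Prop where
  locallyPresentable : IsCardinalLocallyPresentable K α
  strict : ∀ (B A : K) (b : B ⟶ A), IsCardinalPresentable B α →
    ∃ (B' : K) (f : A ⟶ B') (b' : B' ⟶ A), IsCardinalPresentable B' α ∧ b = b ≫ f ≫ b'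

end StrictWidth

/-- A category is algebraically complete if every endofunctor has an initial algebra. -/
def AlgebraicallyComplete (C : Type*) [Category C] : Prop :=
  ∀ F : C ⥤ C, HasInitial (Endofunctor.Algebra F)

/-! By strict width, the objects of power at most `lam` are exactly the `lam⁺`-presentable ones
(`powerLE_iff`). Recursive coalgebras of `F` are therefore closed under `lam⁺`-small colimits; they
form an essentially small `lam⁺`-filtered category, which has a colimit `c` in `K`. This colimit may
be too large for `PowerLE K lam`, so a subcoproduct `X` with at most `lam` components is cut out of
it. Presentability lets `F` act on morphisms from small objects to `c` (`extendMap`). If `F X` and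
`X` are the same subobject of `c`, and recursive coalgebras lying over `X` cover it, then `X` is an
initial algebra (`hasInitial_algebra`).

The components of `X` are the union of a chain of length `lam` of small sets closed step by step.
The difficulty is `F X ≤ X`, because `F` need not preserve unions of chains. `exists_fac_map`
supplies enough preservation by counting. A connected `C` has at most `lam` morphisms into `F` of
the coproduct of `lam` copies of `X`. The functions `lam → lam` embed `X` into that coproduct, and
by a diagonal argument two eventually different embeddings have images under `F` that agree on a
given `C ⟶ F X`. A folding map that splits one embedding sends the other into a stage of the chain.
Folding needs a morphism from `X` to a stage; strictness, applied to the morphism from the initial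
object to `c`, provides it. No assumption on the cofinality of `lam` is needed. -/

namespace StrictWidth

/-! ### A diagonal argument on functions -/

/-- For infinite `lam` and `Λ` the initial well-order of cardinality `lam`, a map out of `Λ → Λ`
with at most `lam` values identifies two eventually different functions. -/
lemma exists_eq_of_eventually_ne {lam : Cardinal.{v}} (hlam : Cardinal.aleph0 ≤ lam)
    {H : Type v} (hH : Cardinal.mk H ≤ lam)
    (G : (lam.ord.ToType → lam.ord.ToType) → H) :
    ∃ (s t : lam.ord.ToType → lam.ord.ToType) (n₀ : lam.ord.ToType),
      G s = G t ∧ ∀ n, n₀ ≤ n → s n ≠ t n := by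
  classical
  have := Cardinal.noMaxOrder hlam
  have hcard : Cardinal.mk lam.ord.ToType = lam := by simp
  obtain ⟨j⟩ : Nonempty (H ↪ lam.ord.ToType) := by
    rw [← Cardinal.le_def, hcard]; exact hH
  choose g hg using fun y : Set.range G => y.2
  -- Diagonalization against one chosen preimage `g y` per value `y`: at place `n` only values of
  -- index below `n`, fewer than `lam` of them, have to be avoided.
  have key : ∀ n : lam.ord.ToType, ∃ x : lam.ord.ToType,
      ∀ y : Set.range G, j y < n → x ≠ g y n := by
    intro n
    by_contra! hcon
    choose y hy hxy using hcon
    have hinj : Function.Injective (fun x => (⟨j (y x), hy x⟩ : Set.Iio n)) := by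
      intro a b hab
      have : y a = y b := Subtype.ext (j.injective (congrArg Subtype.val hab))
      rw [hxy a, hxy b, this]
    have h1 := Cardinal.mk_le_of_injective hinj
    exact absurd h1 (not_le.2 (Cardinal.mk_Iio_lt n (by simp)))
  choose s hs using key
  obtain ⟨n₀, hn₀⟩ := exists_gt (j (G s))
  exact ⟨s, g ⟨G s, s, rfl⟩, n₀, (hg ⟨G s, s, rfl⟩).symm,
    fun n hn => hs n ⟨G s, s, rfl⟩ (lt_of_lt_of_le hn₀ hn)⟩

/-! ### Subcoproducts and factorization through small ones -/

section Subcoproducts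

variable {K : Type u} [Category.{v} K] [HasCoproducts.{v} K] {I : Type v}

/-- The coproduct of the subfamily of `Y` indexed by `S`. -/
noncomputable def subSigma (Y : I → K) (S : Set I) : K := ∐ fun i : S => Y i

/-- The coproduct injections of `subSigma Y S`. -/
noncomputable def subSigma.inj (Y : I → K) {S : Set I} {i : I} (hi : i ∈ S) :
    Y i ⟶ subSigma Y S :=
  Sigma.ι (fun i : S => Y i) ⟨i, hi⟩

/-- Morphisms out of `subSigma Y S`. -/
noncomputable def subSigma.desc {Y : I → K} {S : Set I} {Z : K} (f : ∀ i ∈ S, Y i ⟶ Z) :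
    subSigma Y S ⟶ Z :=
  Sigma.desc fun i : S => f i.1 i.2

lemma subSigma.inj_desc {Y : I → K} {S : Set I} {Z : K} (f : ∀ i ∈ S, Y i ⟶ Z) {i : I}
    (hi : i ∈ S) : subSigma.inj Y hi ≫ subSigma.desc f = f i hi :=
  Sigma.ι_desc (fun i : S => f i.1 i.2) ⟨i, hi⟩

lemma subSigma.inj_desc_assoc {Y : I → K} {S : Set I} {Z : K} (f : ∀ i ∈ S, Y i ⟶ Z) {i : I}
    (hi : i ∈ S) {Z' : K} (h : Z ⟶ Z') :
    subSigma.inj Y hi ≫ subSigma.desc f ≫ h = f i hi ≫ h := by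
  rw [← Category.assoc, subSigma.inj_desc]

lemma subSigma.hom_ext {Y : I → K} {S : Set I} {Z : K} {f g : subSigma Y S ⟶ Z}
    (h : ∀ i (hi : i ∈ S), subSigma.inj Y hi ≫ f = subSigma.inj Y hi ≫ g) : f = g :=
  Sigma.hom_ext _ _ fun i => h i.1 i.2

/-- The inclusion of a subcoproduct into a larger one. -/
noncomputable def subSigma.incl (Y : I → K) {S T : Set I} (h : S ⊆ T) :
    subSigma Y S ⟶ subSigma Y T :=
  subSigma.desc fun _ hi => subSigma.inj Y (h hi)

lemma subSigma.inj_incl (Y : I → K) {S T : Set I} (h : S ⊆ T) {i : I} (hi : i ∈ S) :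
    subSigma.inj Y hi ≫ subSigma.incl Y h = subSigma.inj Y (h hi) := by
  rw [subSigma.incl, subSigma.inj_desc]

lemma subSigma.inj_incl_assoc (Y : I → K) {S T : Set I} (h : S ⊆ T) {i : I} (hi : i ∈ S)
    {Z : K} (f : subSigma Y T ⟶ Z) :
    subSigma.inj Y hi ≫ subSigma.incl Y h ≫ f = subSigma.inj Y (h hi) ≫ f := by
  rw [← Category.assoc, subSigma.inj_incl]

variable {Y : I → K}

/-- The inclusion of a subcoproduct into the coproduct. -/
noncomputable def subSigma.toPt (c : Cofan Y) (S : Set I) : subSigma Y S ⟶ c.pt :=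
  subSigma.desc fun i _ => c.inj i

lemma subSigma.inj_toPt (c : Cofan Y) {S : Set I} {i : I} (hi : i ∈ S) :
    subSigma.inj Y hi ≫ subSigma.toPt c S = c.inj i := by
  rw [subSigma.toPt, subSigma.inj_desc]

lemma subSigma.inj_toPt_assoc (c : Cofan Y) {S : Set I} {i : I} (hi : i ∈ S) {Z : K}
    (f : c.pt ⟶ Z) : subSigma.inj Y hi ≫ subSigma.toPt c S ≫ f = c.inj i ≫ f := by
  rw [← Category.assoc, subSigma.inj_toPt]

lemma subSigma.incl_toPt (c : Cofan Y) {S T : Set I} (h : S ⊆ T) :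
    subSigma.incl Y h ≫ subSigma.toPt c T = subSigma.toPt c S :=
  subSigma.hom_ext fun i hi => by
    rw [subSigma.inj_incl_assoc, subSigma.inj_toPt, subSigma.inj_toPt]

/-- The coproduct splits as the part over `S` plus the part over `Sᶜ`, so this morphism is itself a
coproduct injection. -/
lemma subSigma.mono_toPt
    (hmono : ∀ (I : Type v) (Y : I → K) (c : Cofan Y), IsColimit c → ∀ i, Mono (c.inj i))
    {c : Cofan Y} (hc : IsColimit c) (S : Set I) : Mono (subSigma.toPt c S) := by
  classical
  let T : ULift.{v} Bool → Set I := fun b => if b.down then S else Sᶜ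
  let d : Cofan fun b => subSigma Y (T b) := Cofan.mk c.pt fun b => subSigma.toPt c (T b)
  have memT : ∀ i, i ∈ T ⟨decide (i ∈ S)⟩ := by
    intro i
    by_cases hi : i ∈ S <;> simp [T, hi]
  have hd : IsColimit d := Cofan.IsColimit.mk d
    (fun s => Cofan.IsColimit.desc hc fun i => subSigma.inj Y (memT i) ≫ s.inj _)
    (fun s b => by
      refine subSigma.hom_ext fun i hi => ?_
      obtain rfl : b = ⟨decide (i ∈ S)⟩ := by
        obtain ⟨_ | _⟩ := b
        · have : i ∉ S := hi
          simp [this]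
        · have : i ∈ S := hi
          simp [this]
      change _ ≫ subSigma.toPt c _ ≫ _ = _
      rw [subSigma.inj_toPt_assoc, Cofan.IsColimit.fac])
    (fun s m hm => by
      refine Cofan.IsColimit.hom_ext hc _ _ fun i => ?_
      rw [Cofan.IsColimit.fac, ← hm]
      change _ = _ ≫ subSigma.toPt c _ ≫ _
      rw [subSigma.inj_toPt_assoc])
  exact hmono _ _ d hd ⟨true⟩

variable {θ : Cardinal.{v}} [Fact θ.IsRegular]

/-- A coproduct is the `θ`-filtered colimit of its subcoproducts with fewer than `θ` summands. -/
lemma subSigma.exists_fac {c : Cofan Y} (hc : IsColimit c) {X : K} [IsCardinalPresentable X θ]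
    (f : X ⟶ c.pt) :
    ∃ (S : Set I) (_ : HasCardinalLT S θ) (g : X ⟶ subSigma Y S), g ≫ subSigma.toPt c S = f := by
  let D : HasCardinalLT.Set I θ ⥤ K :=
    { obj := fun S => subSigma Y S.1
      map := fun h => subSigma.incl Y (leOfHom h)
      map_id := fun S => subSigma.hom_ext fun i hi => by
        rw [subSigma.inj_incl, Category.comp_id]
      map_comp := fun f g => subSigma.hom_ext fun i hi => by
        rw [subSigma.inj_incl, subSigma.inj_incl_assoc, subSigma.inj_incl] }
  let d : Cocone D :=
    { pt := c.pt
      ι := { app := fun S => subSigma.toPt c S.1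
             naturality := fun S T h => by
              change subSigma.incl Y (leOfHom h) ≫ _ = _ ≫ 𝟙 _
              rw [subSigma.incl_toPt, Category.comp_id] } }
  have hθ : Cardinal.aleph0 ≤ θ := (Fact.out : θ.IsRegular).aleph0_le
  let single (i : I) : HasCardinalLT.Set I θ :=
    ⟨{i}, hasCardinalLT_of_finite _ _ hθ⟩
  have hd : IsColimit d :=
    { desc := fun s => Cofan.IsColimit.desc hc fun i =>
        subSigma.inj Y (Set.mem_singleton i) ≫ s.ι.app (single i)
      fac := fun s S => subSigma.hom_ext fun i hi => by
        change _ ≫ subSigma.toPt c _ ≫ _ = _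
        have hle : single i ≤ S := Set.singleton_subset_iff.2 hi
        rw [subSigma.inj_toPt_assoc, Cofan.IsColimit.fac, ← s.w (homOfLE hle)]
        change _ ≫ subSigma.incl Y _ ≫ _ = _
        rw [subSigma.inj_incl_assoc]
      uniq := fun s m hm => Cofan.IsColimit.hom_ext hc _ _ fun i => by
        rw [Cofan.IsColimit.fac, ← hm (single i)]
        change _ = _ ≫ subSigma.toPt c _ ≫ _
        rw [subSigma.inj_toPt_assoc] }
  obtain ⟨S, g, hg⟩ := IsCardinalPresentable.exists_hom_of_isColimit θ hd f
  exact ⟨S.1, S.2, g, hg⟩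

end Subcoproducts

/-! ### Recursive coalgebras and their colimits -/

section RecursiveCoalgebras

variable {C : Type u} [Category.{v} C]

/-- A coalgebra is recursive if it has a unique coalgebra-to-algebra morphism into every
algebra. -/
structure RecCoalg (F : C ⥤ C) where
  /-- the underlying object -/
  V : C
  /-- the structure morphism -/
  str : V ⟶ F.obj V
  existsUnique (Y : Endofunctor.Algebra F) : ∃! h : V ⟶ Y.a, str ≫ F.map h ≫ Y.str = h

namespace RecCoalg

variable {F : C ⥤ C}

/-- Coalgebra morphisms. -/
@[ext]
structure Hom (A B : RecCoalg F) where
  /-- the underlying morphism -/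
  f : A.V ⟶ B.V
  w : A.str ≫ F.map f = f ≫ B.str

lemma Hom.w_assoc {A B : RecCoalg F} (f : Hom A B) {Z : C} (h : F.obj B.V ⟶ Z) :
    A.str ≫ F.map f.f ≫ h = f.f ≫ B.str ≫ h := by
  rw [← Category.assoc, f.w, Category.assoc]

@[simps]
instance : Category (RecCoalg F) where
  Hom := Hom
  id A := { f := 𝟙 _, w := by simp }
  comp f g := { f := f.f ≫ g.f, w := by simp [f.w_assoc, g.w] }

@[ext]
lemma hom_ext {A B : RecCoalg F} {f g : A ⟶ B} (h : f.f = g.f) : f = g :=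
  Hom.ext h

/-- The forgetful functor. -/
@[simps]
def forget (F : C ⥤ C) : RecCoalg F ⥤ C where
  obj A := A.V
  map f := f.f

/-- The unique coalgebra-to-algebra morphism from a recursive coalgebra. -/
noncomputable def toAlgebra (A : RecCoalg F) (Y : Endofunctor.Algebra F) : A.V ⟶ Y.a :=
  (A.existsUnique Y).choose

lemma toAlgebra_spec (A : RecCoalg F) (Y : Endofunctor.Algebra F) :
    A.str ≫ F.map (A.toAlgebra Y) ≫ Y.str = A.toAlgebra Y :=
  (A.existsUnique Y).choose_spec.1

lemma eq_toAlgebra {A : RecCoalg F} {Y : Endofunctor.Algebra F} {h : A.V ⟶ Y.a}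
    (hh : A.str ≫ F.map h ≫ Y.str = h) : h = A.toAlgebra Y :=
  (A.existsUnique Y).choose_spec.2 h hh

lemma comp_toAlgebra {A B : RecCoalg F} (f : A ⟶ B) (Y : Endofunctor.Algebra F) :
    f.f ≫ B.toAlgebra Y = A.toAlgebra Y := by
  apply eq_toAlgebra
  rw [F.map_comp, Category.assoc, Hom.w_assoc, toAlgebra_spec]

/-- The recursive coalgebra `F A`. -/
abbrev next (A : RecCoalg F) : RecCoalg F where
  V := F.obj A.V
  str := F.map A.str
  existsUnique Y := by
    refine ⟨F.map (A.toAlgebra Y) ≫ Y.str, ?_, fun g hg => ?_⟩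
    · dsimp only
      rw [← F.map_comp_assoc, toAlgebra_spec]
    · dsimp only at hg
      have : A.str ≫ g = A.toAlgebra Y := eq_toAlgebra (by
        rw [F.map_comp, Category.assoc, hg])
      rw [← this, F.map_comp, Category.assoc, hg]

/-- The structure of `A`, as a morphism of coalgebras. -/
abbrev toNext (A : RecCoalg F) : A ⟶ A.next := Hom.mk A.str rfl

/-- `next` on morphisms. -/
abbrev nextMap {A B : RecCoalg F} (f : A ⟶ B) : A.next ⟶ B.next :=
  Hom.mk (F.map f.f) (by rw [← F.map_comp, ← F.map_comp, f.w])

lemma next_toAlgebra (A : RecCoalg F) (Y : Endofunctor.Algebra F) :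
    A.next.toAlgebra Y = F.map (A.toAlgebra Y) ≫ Y.str := by
  refine (eq_toAlgebra (A := A.next) (Y := Y) ?_).symm
  rw [← F.map_comp_assoc, toAlgebra_spec]

/-- Recursive coalgebras are closed under the colimits that exist in the base category. -/
lemma nonempty_cocone {J : Type*} [Category* J] (D : J ⥤ RecCoalg F)
    [HasColimit (D ⋙ forget F)] : Nonempty (Cocone D) := by
  let c := colimit.cocone (D ⋙ forget F)
  have hc : IsColimit c := colimit.isColimit _
  let κ (j : J) : (D.obj j).V ⟶ c.pt := c.ι.app j
  have hκ {i j : J} (f : i ⟶ j) : (D.map f).f ≫ κ j = κ i := c.w f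
  have hext {Z : C} {f g : c.pt ⟶ Z} (h : ∀ j, κ j ≫ f = κ j ≫ g) : f = g := hc.hom_ext h
  have hdesc {Z : C} (t : ∀ j, (D.obj j).V ⟶ Z)
      (ht : ∀ {i j : J} (f : i ⟶ j), (D.map f).f ≫ t j = t i) :
      ∃ g : c.pt ⟶ Z, ∀ j, κ j ≫ g = t j :=
    ⟨hc.desc
      { pt := Z
        ι :=
        { app := t
          naturality := fun _ _ f => Eq.trans (ht f) (Category.comp_id _).symm } },
      fun j => hc.fac _ j⟩
  obtain ⟨σ, hσ⟩ := hdesc (fun j => (D.obj j).str ≫ F.map (κ j)) fun f => by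
    rw [← Hom.w_assoc, ← F.map_comp, hκ]
  refine ⟨{ pt := ⟨c.pt, σ, fun Y => ?_⟩
            ι := { app := fun j => Hom.mk (κ j) (hσ j).symm
                   naturality := fun i j f => hom_ext ?_ } }⟩
  · obtain ⟨h, hh⟩ := hdesc (fun j => (D.obj j).toAlgebra Y) fun f => comp_toAlgebra _ _
    refine ⟨h, hext fun j => ?_, fun g hg => hext fun j => ?_⟩
    · rw [reassoc_of% hσ, ← F.map_comp_assoc, hh, toAlgebra_spec]
    · rw [hh]
      apply eq_toAlgebra
      rw [F.map_comp_assoc, ← reassoc_of% hσ, hg]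
  · exact (hκ f).trans (Category.comp_id _).symm

lemma isCardinalFiltered (F : C ⥤ C) (θ : Cardinal.{v}) [Fact θ.IsRegular]
    (h : ∀ (J : Type v) [SmallCategory J], HasCardinalLT (Arrow J) θ → HasColimitsOfShape J C) :
    IsCardinalFiltered (RecCoalg F) θ where
  nonempty_cocone {J} _ D hJ := by
    have := h J hJ
    exact nonempty_cocone D

instance : (forget F).Faithful where
  map_injective h := hom_ext h

/-- Recursive structures transport along isomorphisms, and those on a fixed `Y` embed into the set
`Y ⟶ F.obj Y`. -/
lemma essentiallySmall (F : C ⥤ C) [EssentiallySmall.{v} C] :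
    EssentiallySmall.{v} (RecCoalg F) := by
  have : LocallySmall.{v} (RecCoalg F) := locallySmall_of_faithful (forget F)
  refine CategoryTheory.EssentiallySmall.of_functor (forget F)
    (ObjectProperty.EssentiallySmall.of_le (Q := ⊤) le_top) fun Y => ?_
  have hsmall : Small.{v} {A : RecCoalg F // A.V = Y} := by
    refine small_of_injective (β := Y ⟶ F.obj Y)
      (f := fun A => eqToHom A.2.symm ≫ A.1.str ≫ F.map (eqToHom A.2)) ?_
    rintro ⟨⟨V, a, ha⟩, rfl⟩ ⟨⟨V', b, hb⟩, hV⟩ h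
    dsimp at hV
    subst hV
    simpa using h
  have : ObjectProperty.Small.{v} (fun A : RecCoalg F => A.V = Y) := hsmall
  refine ⟨fun A => A.V = Y, this, ?_⟩
  rintro A ⟨e⟩
  replace e : A.V ≅ Y := e
  refine ⟨⟨Y, e.inv ≫ A.str ≫ F.map e.hom, fun Z => ?_⟩, rfl, ⟨?_⟩⟩
  · refine ⟨e.inv ≫ A.toAlgebra Z, ?_, fun g hg => ?_⟩
    · dsimp only
      rw [Category.assoc, Category.assoc, ← F.map_comp_assoc, e.hom_inv_id_assoc, toAlgebra_spec]
    · rw [Iso.eq_inv_comp]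
      apply eq_toAlgebra
      dsimp only at hg
      conv_rhs => rw [← hg]
      simp
  · exact { hom := Hom.mk e.hom (by simp)
            inv := Hom.mk e.inv (by simp [← F.map_comp])
            hom_inv_id := hom_ext e.hom_inv_id
            inv_hom_id := hom_ext e.inv_hom_id }

end RecCoalg

end RecursiveCoalgebras

/-! ### Extending the functor to the colimit of the recursive coalgebras -/

section

variable {K : Type u} [Category.{v} K] {P : ObjectProperty K}
  {F : P.FullSubcategory ⥤ P.FullSubcategory}

namespace RecCoalg

/-- Recursive coalgebras as objects of the ambient category. -/
abbrev toAmbient (F : P.FullSubcategory ⥤ P.FullSubcategory) : RecCoalg F ⥤ K :=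
  forget F ⋙ P.ι

variable (c : Cocone (toAmbient F))

/-- The components of a cocone over the recursive coalgebras. -/
abbrev leg (A : RecCoalg F) : A.V.obj ⟶ c.pt := c.ι.app A

lemma leg_w {A B : RecCoalg F} (f : A ⟶ B) : f.f.hom ≫ leg c B = leg c A := c.w f

lemma str_leg_next (A : RecCoalg F) : A.str.hom ≫ leg c A.next = leg c A := leg_w c A.toNext

lemma leg_w_assoc {A B : RecCoalg F} (f : A ⟶ B) {Z : K} (h : c.pt ⟶ Z) :
    f.f.hom ≫ leg c B ≫ h = leg c A ≫ h := by
  rw [← Category.assoc, leg_w]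

lemma str_leg_next_assoc (A : RecCoalg F) {Z : K} (h : c.pt ⟶ Z) :
    A.str.hom ≫ leg c A.next ≫ h = leg c A ≫ h :=
  leg_w_assoc c A.toNext h

variable {c}

lemma exists_desc (hc : IsColimit c) {Z : K} (t : ∀ A : RecCoalg F, A.V.obj ⟶ Z)
    (ht : ∀ {A B : RecCoalg F} (f : A ⟶ B), f.f.hom ≫ t B = t A) :
    ∃ g : c.pt ⟶ Z, ∀ A, leg c A ≫ g = t A :=
  ⟨hc.desc
    { pt := Z
      ι :=
      { app := t
        naturality := fun _ _ f => Eq.trans (ht f) (Category.comp_id _).symm } },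
    fun j => hc.fac _ j⟩

/-- A colimit `c` of the recursive coalgebras, such that every object of the subcategory behaves
as a presentable object with respect to it. -/
structure IsPresentableColimit (c : Cocone (toAmbient F)) where
  /-- it is a colimit -/
  isColimit : IsColimit c
  exists_fac (X : P.FullSubcategory) (f : X.obj ⟶ c.pt) :
    ∃ (A : RecCoalg F) (s : X ⟶ A.V), s.hom ≫ leg c A = f
  exists_eq {X : P.FullSubcategory} {A B : RecCoalg F} (f : X ⟶ A.V) (g : X ⟶ B.V) :
    f.hom ≫ leg c A = g.hom ≫ leg c B →
      ∃ (D : RecCoalg F) (a : A ⟶ D) (b : B ⟶ D), f ≫ a.f = g ≫ b.f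

namespace IsPresentableColimit

variable (hc : IsPresentableColimit c)

/-- The action of `F` on morphisms from an object of the subcategory to the colimit of the
recursive coalgebras. -/
noncomputable def extendMap {X : P.FullSubcategory} (f : X.obj ⟶ c.pt) :
    (F.obj X).obj ⟶ c.pt :=
  (F.map (hc.exists_fac X f).choose_spec.choose).hom ≫ leg c (hc.exists_fac X f).choose.next

include hc in
-- This makes `extendMap` independent of the chosen factorization: two factorizations are already
-- equalized in some recursive coalgebra `D`, and `next` is functorial.
lemma map_leg_next_eq {X : P.FullSubcategory} {A B : RecCoalg F} {f : X ⟶ A.V} {g : X ⟶ B.V}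
    (h : f.hom ≫ leg c A = g.hom ≫ leg c B) :
    (F.map f).hom ≫ leg c A.next = (F.map g).hom ≫ leg c B.next := by
  obtain ⟨D, a, b, hab⟩ := hc.exists_eq f g h
  have := congrArg (fun k => (F.map k).hom ≫ leg c D.next) hab
  rw [F.map_comp, F.map_comp] at this
  have ha := leg_w c (nextMap a)
  have hb := leg_w c (nextMap b)
  rw [← ha, ← hb]
  simpa using this

lemma extendMap_eq {X : P.FullSubcategory} {A : RecCoalg F} (s : X ⟶ A.V) {f : X.obj ⟶ c.pt}
    (hs : s.hom ≫ leg c A = f) : hc.extendMap f = (F.map s).hom ≫ leg c A.next :=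
  hc.map_leg_next_eq ((hc.exists_fac X f).choose_spec.choose_spec.trans hs.symm)

lemma extendMap_leg (A : RecCoalg F) : hc.extendMap (leg c A) = leg c A.next := by
  rw [hc.extendMap_eq (𝟙 A.V) (Category.id_comp _), F.map_id]
  exact Category.id_comp _

lemma map_extendMap {X Y : P.FullSubcategory} (g : X ⟶ Y) (f : Y.obj ⟶ c.pt) :
    (F.map g).hom ≫ hc.extendMap f = hc.extendMap (g.hom ≫ f) := by
  obtain ⟨A, s, rfl⟩ := hc.exists_fac Y f
  rw [hc.extendMap_eq s rfl, hc.extendMap_eq (g ≫ s) (Category.assoc _ _ _), F.map_comp]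
  exact (Category.assoc _ _ _).symm

include hc in
-- A substitute for `F r`, as `c.pt` need not lie in the domain of `F`: on the leg of `A` it is
-- `A.str` followed by `F` of the restriction of `r`. It transfers a splitting of `f` to `extendMap
-- f`.
lemma exists_coextend {X : P.FullSubcategory} (r : c.pt ⟶ X.obj) :
    ∃ r' : c.pt ⟶ (F.obj X).obj, ∀ (Y : P.FullSubcategory) (f : Y.obj ⟶ c.pt),
      hc.extendMap f ≫ r' = (F.map (ObjectProperty.homMk (f ≫ r) : Y ⟶ X)).hom := by
  let t (A : RecCoalg F) : A.V ⟶ X := ObjectProperty.homMk (leg c A ≫ r)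
  have ht {A B : RecCoalg F} (f : A ⟶ B) : f.f ≫ t B = t A :=
    ObjectProperty.hom_ext _ (leg_w_assoc c f r)
  obtain ⟨r', hr'⟩ := exists_desc hc.isColimit (fun A => (A.str ≫ F.map (t A)).hom) (fun f => by
    rw [← ht f, F.map_comp, f.w_assoc]
    rfl)
  refine ⟨r', fun Y f => ?_⟩
  obtain ⟨A, s, rfl⟩ := hc.exists_fac Y f
  have h1 : A.str ≫ t A.next = t A := ObjectProperty.hom_ext _ (str_leg_next_assoc c A r)
  have h2 : (ObjectProperty.homMk ((s.hom ≫ leg c A) ≫ r) : Y ⟶ X) = s ≫ t A :=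
    ObjectProperty.hom_ext _ (Category.assoc _ _ _)
  rw [hc.extendMap_eq s rfl, Category.assoc, hr', h2, F.map_comp, ← h1, F.map_comp]
  rfl

include hc in
lemma exists_toAlgebra (Y : Endofunctor.Algebra F) :
    ∃ h : c.pt ⟶ Y.a.obj, (∀ A : RecCoalg F, leg c A ≫ h = (A.toAlgebra Y).hom) ∧
      ∀ (X : P.FullSubcategory) (f : X.obj ⟶ c.pt),
        hc.extendMap f ≫ h =
          (F.map (ObjectProperty.homMk (f ≫ h) : X ⟶ Y.a) ≫ Y.str).hom := by
  obtain ⟨h, hh⟩ := exists_desc hc.isColimit (fun A => (A.toAlgebra Y).hom) (fun f => by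
    rw [← comp_toAlgebra f]
    rfl)
  refine ⟨h, hh, fun X f => ?_⟩
  obtain ⟨A, s, rfl⟩ := hc.exists_fac X f
  have h2 : (ObjectProperty.homMk ((s.hom ≫ leg c A) ≫ h) : X ⟶ Y.a) = s ≫ A.toAlgebra Y :=
    ObjectProperty.hom_ext _ ((Category.assoc _ _ _).trans (congrArg _ (hh A)))
  rw [hc.extendMap_eq s rfl, Category.assoc, hh, h2, F.map_comp, next_toAlgebra, Category.assoc]
  rfl

/-- A morphism over the colimit from a recursive coalgebra to a fixed point of the extended
functor is compatible with the structures. -/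
lemma str_map_comp {X : P.FullSubcategory} {i : X.obj ⟶ c.pt} [Mono i] {x : F.obj X ⟶ X}
    (hx : x.hom ≫ i = hc.extendMap i) {A : RecCoalg F} {t : A.V ⟶ X}
    (ht : t.hom ≫ i = leg c A) : A.str ≫ F.map t ≫ x = t := by
  refine ObjectProperty.hom_ext _ ((cancel_mono i).1 ?_)
  change (A.str.hom ≫ (F.map t).hom ≫ x.hom) ≫ i = t.hom ≫ i
  rw [Category.assoc, Category.assoc, hx, hc.map_extendMap, ht, hc.extendMap_leg, str_leg_next]

/-- Existence restricts the canonical morphism `c.pt ⟶ Y.a` along `i`. For uniqueness, an algebra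
morphism precomposed with a coalgebra lying over `X` is forced by recursiveness, and such coalgebras
are jointly epic by `hX`. -/
theorem hasInitial_algebra {X : P.FullSubcategory} {i : X.obj ⟶ c.pt} [Mono i] (x : F.obj X ≅ X)
    (hx : x.hom.hom ≫ i = hc.extendMap i)
    (hX : ∀ {Y : P.FullSubcategory} {f g : X ⟶ Y},
      (∀ (A : RecCoalg F) (t : A.V ⟶ X), t.hom ≫ i = leg c A → t ≫ f = t ≫ g) → f = g) :
    HasInitial (Endofunctor.Algebra F) := by
  have hex : ∀ Y : Endofunctor.Algebra F, ∃ f : X ⟶ Y.a, F.map f ≫ Y.str = x.hom ≫ f ∧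
      ∀ g : X ⟶ Y.a, F.map g ≫ Y.str = x.hom ≫ g → g = f := by
    intro Y
    obtain ⟨h, hA, hh⟩ := hc.exists_toAlgebra Y
    refine ⟨ObjectProperty.homMk (i ≫ h), ?_, fun g hg => hX fun A t ht => ?_⟩
    · refine ObjectProperty.hom_ext _ ?_
      rw [← hh, ← hx]
      exact Category.assoc _ _ _
    · have h1 : t ≫ g = A.toAlgebra Y := eq_toAlgebra (by
        rw [F.map_comp, Category.assoc, hg, ← Category.assoc (F.map t), ← Category.assoc A.str,
          hc.str_map_comp hx ht])
      rw [h1]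
      refine ObjectProperty.hom_ext _ ?_
      rw [← hA, ← ht]
      exact Category.assoc _ _ _
  choose f hf hu using hex
  refine IsInitial.hasInitial (X := (⟨X, x.hom⟩ : Endofunctor.Algebra F))
    (IsInitial.ofUniqueHom (fun Y => ⟨f Y, hf Y⟩) fun Y m => ?_)
  exact Endofunctor.Algebra.Hom.ext (hu Y m.f m.h)

end IsPresentableColimit

end RecCoalg

end

/-! ### Power, presentability and hom-set bounds -/

section Width

variable {K : Type u} [Category.{v} K]

lemma IsPresentableFor.isCardinalPresentable {X : K} {κ θ : Cardinal.{v}} [Fact θ.IsRegular]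
    (h : IsPresentableFor X κ) (hκ : κ ≤ θ) : IsCardinalPresentable X θ := by
  refine ⟨fun J _ _ => h J fun A _ D hA => ?_⟩
  exact IsCardinalFiltered.nonempty_cocone (κ := θ) D
    ((hasCardinalLT_iff_cardinal_mk_lt _ _).2 (hA.trans_le hκ))

variable {w lam : Cardinal.{v}}

lemma HasStrictWidth.isCardinalPresentable (hw : HasStrictWidth K w) (hlam : w ≤ lam)
    (hlam' : Cardinal.aleph0 ≤ lam) [Fact (Order.succ lam).IsRegular] {X : K}
    (hX : IsConnectedObj X) : IsCardinalPresentable X (Order.succ lam) :=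
  (hw.presentable X hX).isCardinalPresentable
    ((Cardinal.add_le_of_le hlam' hlam hlam').trans (Order.le_succ lam))

lemma hasCardinalLT_succ_iff {X : Type v} : HasCardinalLT X (Order.succ lam) ↔
    Cardinal.mk X ≤ lam := by
  rw [hasCardinalLT_iff_cardinal_mk_lt, Order.lt_succ_iff]

/-- The objects of power at most `lam` are the `lam⁺`-presentable objects. -/
lemma HasStrictWidth.powerLE_iff (hw : HasStrictWidth K w) (hlam : w ≤ lam)
    (hlam' : Cardinal.aleph0 ≤ lam) [Fact (Order.succ lam).IsRegular] (X : K) :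
    powerLE K lam X ↔ IsCardinalPresentable X (Order.succ lam) := by
  have := hw.hasCoproducts
  constructor
  · rintro ⟨κ, hκ, I, Y, inj, rfl, hY, ⟨hc⟩⟩
    have : ∀ k, IsCardinalPresentable ((Discrete.functor Y).obj k) (Order.succ lam) :=
      fun k => hw.isCardinalPresentable hlam hlam' (hY k.as)
    exact isCardinalPresentable_of_isColimit _ hc (Order.succ lam)
      (by simpa using hasCardinalLT_succ_iff.2 hκ)
  · intro hX
    obtain ⟨κ, I, Y, inj, rfl, hY, ⟨hc⟩⟩ := hw.exists_power X
    obtain ⟨S, hS, g, hg⟩ := subSigma.exists_fac (θ := Order.succ lam) hc (𝟙 X)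
    have := subSigma.mono_toPt hw.mono_inj hc S
    -- The inclusion of the small subcoproduct is monic and split epic, hence invertible.
    have hg' : subSigma.toPt (Cofan.mk X inj) S ≫ g = 𝟙 _ := by
      rw [← cancel_mono (subSigma.toPt (Cofan.mk X inj) S), Category.assoc, hg]
      exact (Category.comp_id _).trans (Category.id_comp _).symm
    let e : (∐ fun i : S => Y i) ≅ X := ⟨subSigma.toPt (Cofan.mk X inj) S, g, hg', hg⟩
    refine ⟨Cardinal.mk S, hasCardinalLT_succ_iff.1 hS, S, fun i => Y i,
      fun i => Sigma.ι (fun i : S => Y i) i ≫ e.hom, rfl, fun i => hY i, ⟨?_⟩⟩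
    exact (coproductIsCoproduct fun i : S => Y i).ofIsoColimit
      (Cocone.ext e fun _ => rfl)

lemma HasWidth.essentiallySmall_powerLE (hw : HasWidth K w) (lam : Cardinal.{v}) :
    ObjectProperty.EssentiallySmall.{v} (powerLE K lam) := by
  have := hw.hasCoproducts
  obtain ⟨J, R, -, hR⟩ := hw.isLeast.1.1
  refine ⟨.ofObj fun p : Σ S : Set lam.ord.ToType, S → J => ∐ fun i => R (p.2 i),
    inferInstance, ?_⟩
  rintro X ⟨κ, hκ, I, Y, inj, rfl, hY, ⟨hc⟩⟩
  choose j hj using fun i => hR (Y i) (hY i)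
  obtain ⟨m⟩ : Nonempty (I ↪ lam.ord.ToType) := by
    rw [← Cardinal.le_def]
    simpa using hκ
  let e : I ≃ Set.range m := Equiv.ofInjective m m.injective
  refine ⟨_, ⟨⟨Set.range m, fun x => j (e.symm x)⟩⟩, ⟨?_⟩⟩
  have e₁ : X ≅ ∐ Y := hc.coconePointUniqueUpToIso (coproductIsCoproduct Y)
  have e₂ : ∐ Y ≅ ∐ fun i => R (j i) := Sigma.mapIso fun i => (hj i).some
  have e₃ : (∐ fun x => R (j (e.symm x))) ≅ ∐ fun i => R (j i) :=
    Sigma.reindex e.symm fun i => R (j i)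
  exact e₁ ≪≫ e₂ ≪≫ e₃.symm

/-- Condition (b) bounds morphisms into objects of power exactly `lam`, so `X` is padded with `lam`
copies of `C`; `X` embeds monically into the result. -/
lemma HasStrictWidth.mk_hom_le (hw : HasStrictWidth K w) (hlam : w ≤ lam)
    (hlam' : Cardinal.aleph0 ≤ lam) {C X : K} (hC : IsConnectedObj C) (hX : powerLE K lam X) :
    Cardinal.mk (C ⟶ X) ≤ lam := by
  have := hw.hasCoproducts
  obtain ⟨κ, hκ, I, Y, inj, rfl, hY, ⟨hc⟩⟩ := hX
  let Z : I ⊕ lam.ord.ToType → K := Sum.elim Y fun _ => C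
  have hZ : ∀ k, IsConnectedObj (Z k) := by
    rintro (i | _)
    exacts [hY i, hC]
  have hpow : HasPower (∐ Z) lam :=
    ⟨_, Z, Sigma.ι Z, by
      simpa using Cardinal.add_eq_right hlam' hκ, hZ, ⟨coproductIsCoproduct Z⟩⟩
  let c : Cofan Z := Cofan.mk (∐ Z) (Sigma.ι Z)
  have hmono := subSigma.mono_toPt hw.mono_inj (c := c) (coproductIsCoproduct Z)
    (Set.range Sum.inl)
  let g (i : I) : Y i ⟶ subSigma Z (Set.range Sum.inl) :=
    subSigma.inj Z (i := Sum.inl i) (Set.mem_range_self i)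
  let f : X ⟶ subSigma Z (Set.range Sum.inl) := Cofan.IsColimit.desc hc g
  have hf (i : I) : inj i ≫ f = g i := Cofan.IsColimit.fac hc g i
  let r : ∀ k, k ∈ Set.range (Sum.inl : I → I ⊕ lam.ord.ToType) → (Z k ⟶ X)
    | .inl i, _ => inj i
    | .inr _, h => by simp at h
  have : IsSplitMono f := ⟨⟨subSigma.desc r, Cofan.IsColimit.hom_ext hc _ _ fun i => by
    change inj i ≫ _ = inj i ≫ 𝟙 X
    rw [reassoc_of% hf, Category.comp_id]
    exact subSigma.inj_desc r (Set.mem_range_self i)⟩⟩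
  have hinj : Function.Injective fun g : C ⟶ X => (g ≫ f) ≫ subSigma.toPt c _ := by
    intro a b hab
    exact (cancel_mono f).1 ((cancel_mono (subSigma.toPt c _)).1 hab)
  exact (Cardinal.mk_le_of_injective hinj).trans (hw.isLeast.1.2 lam hlam C _ hC hpow)

end Width

/-! ### Chains of subcoproducts and the counting argument -/

/-- Iterating an operation on small subsets along the initial ordinal of `lam`. -/
lemma exists_iterate {lam : Cardinal.{v}} [Fact (Order.succ lam).IsRegular] {I : Type v}
    (Φ : Set I → Set I)
    (hΦ : ∀ S : Set I, HasCardinalLT S (Order.succ lam) → HasCardinalLT (Φ S) (Order.succ lam)) :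
    ∃ T : lam.ord.ToType → Set I, Monotone T ∧ (∀ m n, m < n → Φ (T m) ⊆ T n) ∧
      (∀ n, HasCardinalLT (T n) (Order.succ lam)) ∧
      HasCardinalLT (⋃ n, T n : Set I) (Order.succ lam) := by
  let T : lam.ord.ToType → Set I := wellFounded_lt.fix fun n ih => ⋃ m : Set.Iio n, Φ (ih m m.2)
  have hT n : T n = ⋃ m : Set.Iio n, Φ (T m) := wellFounded_lt.fix_eq _ n
  have hlt : ∀ m n, m < n → Φ (T m) ⊆ T n := fun m n hmn => by
    rw [hT n]
    exact Set.subset_iUnion (fun m : Set.Iio n => Φ (T m)) ⟨m, hmn⟩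
  have hΛ : HasCardinalLT lam.ord.ToType (Order.succ lam) := hasCardinalLT_succ_iff.2 (by simp)
  have hsmall : ∀ n, HasCardinalLT (T n) (Order.succ lam) := fun n => by
    induction n using WellFoundedLT.induction with
    | ind n ih =>
      rw [hT n]
      exact hasCardinalLT_iUnion _ (hΛ.of_injective _ Subtype.val_injective)
        fun m => hΦ _ (ih m m.2)
  refine ⟨T, fun m n hmn => ?_, hlt, hsmall, hasCardinalLT_iUnion _ hΛ hsmall⟩
  rw [hT m]
  exact Set.iUnion_subset fun k => hlt _ _ (lt_of_lt_of_le k.2 hmn)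

section

variable {K : Type u} [Category.{v} K] [HasCoproducts.{v} K] {lam : Cardinal.{v}}

lemma powerLE_sigma {J : Type v} {Z : J → K} (hZ : ∀ j, IsConnectedObj (Z j))
    (hJ : Cardinal.mk J ≤ lam) : powerLE K lam (∐ Z) :=
  ⟨_, hJ, J, Z, Sigma.ι Z, rfl, hZ, ⟨coproductIsCoproduct Z⟩⟩

/-- A subcoproduct of connected objects, as an object of `PowerLE K lam`. -/
noncomputable abbrev subPowerLE {I : Type v} {Y : I → K} (hY : ∀ i, IsConnectedObj (Y i))
    (S : Set I) (hS : HasCardinalLT S (Order.succ lam)) : PowerLE K lam :=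
  ⟨subSigma Y S, powerLE_sigma (fun i => hY i) (hasCardinalLT_succ_iff.1 hS)⟩

/-- A morphism from a connected object to the value of an endofunctor at the union of a chain of
length `lam` of subcoproducts factorizes through the value at a member of the chain. -/
theorem exists_fac_map {w : Cardinal.{v}} (hw : HasStrictWidth K w) (hlam : w ≤ lam)
    (hlam' : Cardinal.aleph0 ≤ lam) (F : PowerLE K lam ⥤ PowerLE K lam)
    {I : Type v} {Y : I → K} (hY : ∀ i, IsConnectedObj (Y i))
    {T : lam.ord.ToType → Set I} (hT : Monotone T)
    (hTsmall : ∀ n, HasCardinalLT (T n) (Order.succ lam))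
    (hS : HasCardinalLT (⋃ n, T n : Set I) (Order.succ lam))
    {n₁ : lam.ord.ToType} (b : subSigma Y (⋃ n, T n) ⟶ subSigma Y (T n₁))
    {C : K} (hC : IsConnectedObj C) (a : C ⟶ (F.obj (subPowerLE hY _ hS)).obj) :
    ∃ (n : lam.ord.ToType) (a' : C ⟶ (F.obj (subPowerLE hY (T n) (hTsmall n))).obj),
      a' ≫ (F.map (ObjectProperty.homMk (subSigma.incl Y (Set.subset_iUnion T n)) :
        subPowerLE hY (T n) (hTsmall n) ⟶ subPowerLE hY _ hS)).hom = a := by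
  classical
  set S : Set I := ⋃ n, T n with hSdef
  choose rk hrk using fun i : S => Set.mem_iUnion.1 i.2
  -- Every component gets `lam` copies; `inc s` sends the component `i`, first recorded at stage `rk
  -- i`, to its copy number `s (rk i)`.
  let Z : S × lam.ord.ToType → K := fun p => Y p.1
  let Big : PowerLE K lam := ⟨∐ Z, powerLE_sigma (fun p => hY p.1) (by
    simpa using Cardinal.mul_le_of_le hlam' (hasCardinalLT_succ_iff.1 hS) le_rfl)⟩
  let X : PowerLE K lam := subPowerLE hY _ hS
  let inc (s : lam.ord.ToType → lam.ord.ToType) : X ⟶ Big := ObjectProperty.homMk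
    (subSigma.desc fun i hi => Sigma.ι Z (⟨i, hi⟩, s (rk ⟨i, hi⟩)))
  let incl (n) : subPowerLE hY (T n) (hTsmall n) ⟶ X :=
    ObjectProperty.homMk (subSigma.incl Y (Set.subset_iUnion T n))
  obtain ⟨s, t, n₀, hst, hne⟩ := exists_eq_of_eventually_ne hlam'
    (hw.mk_hom_le hlam hlam' hC (F.obj Big).property) fun s => a ≫ (F.map (inc s)).hom
  -- The folding is the identity on the copies used by `inc t`, and goes through `b` into stage `n₁`
  -- on all others.
  let q : Big ⟶ X := ObjectProperty.homMk (Sigma.desc fun p : S × lam.ord.ToType =>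
    if p.2 = t (rk p.1) then subSigma.inj Y p.1.2
    else subSigma.inj Y p.1.2 ≫ b ≫ subSigma.incl Y (Set.subset_iUnion T n₁))
  let n := max n₀ n₁
  -- Where `s` and `t` agree, `rk` is below `n₀`, so the component is already in `T n`; elsewhere
  -- `q` goes through `T n₁`. Hence `inc s ≫ q` lands in `T n`.
  let g₀ : subSigma Y S ⟶ subSigma Y (T n) := subSigma.desc fun i hi =>
    if h : s (rk ⟨i, hi⟩) = t (rk ⟨i, hi⟩) then
      subSigma.inj Y (hT ((lt_of_not_ge fun h' => hne _ h' h).le.trans (le_max_left _ _))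
        (hrk ⟨i, hi⟩))
    else subSigma.inj Y hi ≫ b ≫ subSigma.incl Y (hT (le_max_right _ _))
  let g : X ⟶ subPowerLE hY (T n) (hTsmall n) := ObjectProperty.homMk g₀
  have hq (s) (i) (hi : i ∈ S) : subSigma.inj Y hi ≫ (inc s).hom ≫ q.hom =
      if s (rk ⟨i, hi⟩) = t (rk ⟨i, hi⟩) then subSigma.inj Y hi
      else subSigma.inj Y hi ≫ b ≫ subSigma.incl Y (Set.subset_iUnion T n₁) := by
    dsimp only [inc, q, ObjectProperty.homMk_hom]
    rw [subSigma.inj_desc_assoc]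
    exact Sigma.ι_desc _ _
  have h1 : inc t ≫ q = 𝟙 X := ObjectProperty.hom_ext _ (subSigma.hom_ext fun i hi => by
    refine (hq t i hi).trans ?_
    rw [if_pos rfl]
    exact (Category.comp_id _).symm)
  have h2 : inc s ≫ q = g ≫ incl n := ObjectProperty.hom_ext _ (subSigma.hom_ext fun i hi => by
    refine (hq s i hi).trans ?_
    change _ = subSigma.inj Y hi ≫ g₀ ≫ subSigma.incl Y (Set.subset_iUnion T n)
    rw [subSigma.inj_desc_assoc]
    split_ifs with h
    · rw [subSigma.inj_incl]
    · rw [Category.assoc, Category.assoc]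
      congr 2
      refine subSigma.hom_ext fun j hj => ?_
      rw [subSigma.inj_incl, subSigma.inj_incl_assoc, subSigma.inj_incl])
  refine ⟨n, a ≫ (F.map g).hom, ?_⟩
  calc (a ≫ (F.map g).hom) ≫ (F.map (incl n)).hom
      = a ≫ (F.map (g ≫ incl n)).hom := by
        rw [F.map_comp]; exact Category.assoc _ _ _
    _ = (a ≫ (F.map (inc s)).hom) ≫ (F.map q).hom := by
        rw [← h2, F.map_comp]; exact (Category.assoc _ _ _).symm
    _ = (a ≫ (F.map (inc t)).hom) ≫ (F.map q).hom := by rw [hst]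
    _ = a ≫ (F.map (inc t ≫ q)).hom := by
        rw [F.map_comp]; exact Category.assoc _ _ _
    _ = a := by rw [h1, F.map_id]; exact Category.comp_id _

end

/-! ### Cutting the initial algebra out of the colimit -/

section

variable {K : Type u} [Category.{v} K] {w lam : Cardinal.{v}}

lemma HasStrictWidth.exists_isPresentableColimit [HasColimitsOfSize.{v, v} K]
    (hw : HasStrictWidth K w) (hlam : w ≤ lam) (hlam' : Cardinal.aleph0 ≤ lam)
    [Fact (Order.succ lam).IsRegular] (F : PowerLE K lam ⥤ PowerLE K lam) :
    ∃ c : Cocone (RecCoalg.toAmbient F), Nonempty (RecCoalg.IsPresentableColimit c) := by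
  have hP : powerLE K lam = CategoryTheory.isCardinalPresentable K (Order.succ lam) :=
    funext fun X => propext (hw.powerLE_iff hlam hlam' X)
  have hpres (X : PowerLE K lam) : IsCardinalPresentable X.obj (Order.succ lam) :=
    (hw.powerLE_iff hlam hlam' X.obj).1 X.property
  have : IsCardinalFiltered (RecCoalg F) (Order.succ lam) :=
    RecCoalg.isCardinalFiltered F _ fun J _ hJ => by
      have : (powerLE K lam).IsClosedUnderColimitsOfShape J := by
        rw [hP]
        exact isClosedUnderColimitsOfShape_isCardinalPresentable K
          (κ := Order.succ lam) hJ
      infer_instance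
  have := hw.essentiallySmall_powerLE lam
  have : EssentiallySmall.{v} (RecCoalg F) := RecCoalg.essentiallySmall F
  have : HasColimitsOfShape (RecCoalg F) K :=
    hasColimitsOfShape_of_equivalence (equivSmallModel.{v} (RecCoalg F)).symm
  have hc := colimit.isColimit (RecCoalg.toAmbient F)
  refine ⟨_, ⟨⟨hc, fun X f => ?_, fun f g h => ?_⟩⟩⟩
  · obtain ⟨A, s, hs⟩ := IsCardinalPresentable.exists_hom_of_isColimit (Order.succ lam) hc f
    exact ⟨A, ObjectProperty.homMk s, hs⟩
  · obtain ⟨D, a, b, hab⟩ :=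
      IsCardinalPresentable.exists_eq_of_isColimit (Order.succ lam) hc f.hom g.hom h
    exact ⟨D, a, b, ObjectProperty.hom_ext _ hab⟩

/-- In a strictly locally presentable category every object has a morphism into a small
subcoproduct of any of its coproduct decompositions. -/
lemma IsStrictlyLocallyPresentable.exists_hom_subSigma {α θ : Cardinal.{v}} [Fact α.IsRegular]
    [Fact θ.IsRegular] (hK : IsStrictlyLocallyPresentable K α) (hαθ : α ≤ θ)
    [HasCoproducts.{v} K] {I : Type v} {Y : I → K} {c : Cofan Y} (hc : IsColimit c) :
    ∃ S : Set I, HasCardinalLT S θ ∧ Nonempty (c.pt ⟶ subSigma Y S) := by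
  have := hK.locallyPresentable
  have : HasInitial K := hasColimitsOfShape_of_equivalence
    (Discrete.equivalence (Equiv.equivOfIsEmpty PEmpty.{v + 1} PEmpty.{1}))
  -- For the morphism from the initial object the factorization equation is vacuous; what strictness
  -- yields is the morphism `f` from `c.pt` to an `α`-presentable object.
  have hinit : IsCardinalPresentable (⊥_ K) α := by
    have : ∀ k, IsCardinalPresentable ((Functor.empty.{0} K).obj k) α := fun k => k.as.elim
    exact isCardinalPresentable_of_isColimit _ (colimit.isColimit (Functor.empty.{0} K)) α
      (hasCardinalLT_of_finite _ _ (Fact.out : α.IsRegular).aleph0_le)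
  obtain ⟨B, f, b, hB, -⟩ := hK.strict _ c.pt (initial.to c.pt) hinit
  have := isCardinalPresentable_of_le B hαθ
  obtain ⟨S, hS, g, -⟩ := subSigma.exists_fac (θ := θ) hc b
  exact ⟨S, hS, ⟨f ≫ g⟩⟩

theorem algebraicallyComplete_powerLE {α : Cardinal.{v}} [Fact α.IsRegular]
    (hK : IsStrictlyLocallyPresentable K α) (hw : HasStrictWidth K w) (hα : α ≤ lam)
    (hlam : w ≤ lam) : AlgebraicallyComplete (PowerLE K lam) := by
  classical
  intro F
  have hlam' : Cardinal.aleph0 ≤ lam := (Fact.out : α.IsRegular).aleph0_le.trans hα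
  have : Fact (Order.succ lam).IsRegular := ⟨Cardinal.isRegular_succ hlam'⟩
  have := hK.locallyPresentable
  have := hw.hasCoproducts
  have := Cardinal.noMaxOrder hlam'
  have hpres (X : PowerLE K lam) : IsCardinalPresentable X.obj (Order.succ lam) :=
    (hw.powerLE_iff hlam hlam' X.obj).1 X.property
  obtain ⟨c, ⟨hc⟩⟩ := hw.exists_isPresentableColimit hlam hlam' F
  obtain ⟨κ, I, Y, inj, -, hY, ⟨hd⟩⟩ := hw.exists_power c.pt
  let ι (S : Set I) : subSigma Y S ⟶ c.pt := subSigma.toPt (Cofan.mk c.pt inj) S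
  have hι {S : Set I} {i : I} (hi : i ∈ S) : subSigma.inj Y hi ≫ ι S = inj i :=
    subSigma.inj_toPt (Cofan.mk c.pt inj) hi
  have hιincl {S T : Set I} (h : S ⊆ T) : subSigma.incl Y h ≫ ι T = ι S :=
    subSigma.incl_toPt (Cofan.mk c.pt inj) h
  have hmono (S : Set I) : Mono (ι S) := subSigma.mono_toPt hw.mono_inj hd S
  have hfac (X : PowerLE K lam) (f : X.obj ⟶ c.pt) :
      ∃ S : Set I, HasCardinalLT S (Order.succ lam) ∧ ∃ g : X.obj ⟶ subSigma Y S, g ≫ ι S = f := by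
    obtain ⟨S, hS, g, hg⟩ := subSigma.exists_fac (θ := Order.succ lam) hd f
    exact ⟨S, hS, g, hg⟩
  have hmonotone {X : K} {f : X ⟶ c.pt} {S T : Set I} (h : S ⊆ T)
      (hf : ∃ g : X ⟶ subSigma Y S, g ≫ ι S = f) : ∃ g : X ⟶ subSigma Y T, g ≫ ι T = f := by
    obtain ⟨g, hg⟩ := hf
    exact ⟨g ≫ subSigma.incl Y h, by rw [Category.assoc, hιincl, hg]⟩
  obtain ⟨base, hbase, ⟨r⟩⟩ := hK.exists_hom_subSigma (hα.trans (Order.le_succ lam)) hd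
  replace r : c.pt ⟶ subSigma Y base := r
  -- every component of the colimit lies over a recursive coalgebra
  have hcover (i : I) : ∃ A : RecCoalg F, (∃ a : Y i ⟶ A.V.obj, a ≫ RecCoalg.leg c A = inj i) ∧
      ∃ S : Set I, HasCardinalLT S (Order.succ lam) ∧
        ∃ g : A.V.obj ⟶ subSigma Y S, g ≫ ι S = RecCoalg.leg c A := by
    have : powerLE K lam (Y i) := (hw.powerLE_iff hlam hlam' _).2
      (hw.isCardinalPresentable hlam hlam' (hY i))
    obtain ⟨A, s, hs⟩ := hc.exists_fac ⟨Y i, this⟩ (inj i)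
    exact ⟨A, ⟨s.hom, hs⟩, hfac A.V _⟩
  choose A hA φ hφ hφA using hcover
  -- the closure operation on small subsets
  have hΦ : ∀ S : Set I, ∃ R : Set I, ∀ hS : HasCardinalLT S (Order.succ lam),
      HasCardinalLT R (Order.succ lam) ∧ base ⊆ R ∧ (∀ i ∈ S, φ i ⊆ R) ∧
      ∃ g, g ≫ ι R = hc.extendMap (X := subPowerLE hY S hS) (ι S) := by
    intro S
    by_cases hS : HasCardinalLT S (Order.succ lam)
    · obtain ⟨R, hR, hg⟩ := hfac _ (hc.extendMap (X := subPowerLE hY S hS) (ι S))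
      have hle := (Fact.out : (Order.succ lam).IsRegular).aleph0_le
      refine ⟨(base ∪ ⋃ i : S, φ i) ∪ R, fun _ =>
        ⟨hasCardinalLT_union hle (hasCardinalLT_union hle hbase
          (hasCardinalLT_iUnion _ hS fun i => hφ i)) hR,
          fun x hx => Or.inl (Or.inl hx),
          fun i hi x hx => Or.inl (Or.inr (Set.mem_iUnion.2 ⟨⟨i, hi⟩, hx⟩)), ?_⟩⟩
      exact hmonotone Set.subset_union_right hg
    -- An arbitrary value on large sets, so that `Φ` is total.
    · exact ⟨∅, fun h => absurd h hS⟩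
  choose Φ hΦ using hΦ
  obtain ⟨T, hT, hΦT, hTsmall, hS⟩ := exists_iterate Φ fun S hS => (hΦ S hS).1
  set S : Set I := ⋃ n, T n with hSdef
  have hTS (n) : T n ⊆ S := Set.subset_iUnion T n
  let X : PowerLE K lam := subPowerLE hY S hS
  have hmem {i : I} (hi : i ∈ S) : φ i ⊆ S := by
    obtain ⟨n, hn⟩ := Set.mem_iUnion.1 hi
    obtain ⟨m, hm⟩ := exists_gt n
    exact ((hΦ _ (hTsmall n)).2.2.1 i hn).trans ((hΦT n m hm).trans (hTS m))
  obtain ⟨n₁, hn₁⟩ : ∃ n, base ⊆ T n := by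
    obtain ⟨n⟩ : Nonempty lam.ord.ToType := by
      rw [Ordinal.nonempty_toType_iff]
      exact (Cardinal.ord_eq_zero.not.2 (Cardinal.aleph0_pos.trans_le hlam').ne')
    obtain ⟨m, hm⟩ := exists_gt n
    exact ⟨m, (hΦ _ (hTsmall n)).2.1.trans (hΦT n m hm)⟩
  let i : X.obj ⟶ c.pt := ι S
  have : Mono i := hmono S
  have : Mono (hc.extendMap i) := by
    -- The identity on the components in `S`, and `r` into `base ⊆ S` on the rest, so `i` is split
    -- monic. `exists_coextend` turns this into a splitting of `hc.extendMap i`.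
    let r' : c.pt ⟶ X.obj := Cofan.IsColimit.desc hd fun j =>
      if hj : j ∈ S then subSigma.inj Y hj else inj j ≫ r ≫ subSigma.incl Y (hn₁.trans (hTS n₁))
    have hr' (j : I) : inj j ≫ r' =
        if hj : j ∈ S then subSigma.inj Y hj else
          inj j ≫ r ≫ subSigma.incl Y (hn₁.trans (hTS n₁)) := Cofan.IsColimit.fac hd _ j
    have hir : i ≫ r' = 𝟙 X.obj := subSigma.hom_ext fun j hj => by
      rw [reassoc_of% hι hj, hr', dif_pos hj]
      exact (Category.comp_id _).symm
    obtain ⟨ρ, hρ⟩ := hc.exists_coextend r'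
    have h1 : hc.extendMap i ≫ ρ = 𝟙 _ := by
      have h2 : (ObjectProperty.homMk (i ≫ r') : X ⟶ X) = 𝟙 X := ObjectProperty.hom_ext _ hir
      rw [hρ, h2, F.map_id]
      rfl
    exact mono_of_mono_fac (h := 𝟙 _) h1
  -- the structure morphism
  obtain ⟨x, hx⟩ : ∃ x : F.obj X ⟶ X, x.hom ≫ i = hc.extendMap i := by
    obtain ⟨μ, -, J, C, injF, -, hC, ⟨hF⟩⟩ := (F.obj X).property
    have hj (j : J) : ∃ g : C j ⟶ X.obj, g ≫ i = injF j ≫ hc.extendMap i := by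
      -- Each component of `F X` comes from `F` of some stage `T n`, whose extension into `c.pt`
      -- factors through `Φ (T n)`, contained in a later stage.
      obtain ⟨n, a, ha⟩ := exists_fac_map hw hlam hlam' F hY hT hTsmall hS
        (ι S ≫ r ≫ subSigma.incl Y hn₁) (hC j) (injF j)
      obtain ⟨m, hm⟩ := exists_gt n
      obtain ⟨g, hg⟩ := hmonotone ((hΦT n m hm).trans (hTS m)) (hΦ _ (hTsmall n)).2.2.2
      refine ⟨a ≫ g, ?_⟩
      rw [← ha, Category.assoc, Category.assoc, hc.map_extendMap]
      change a ≫ g ≫ ι S = a ≫ hc.extendMap (subSigma.incl Y (hTS n) ≫ ι S)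
      rw [hg, hιincl]
    choose g hg using hj
    refine ⟨ObjectProperty.homMk (Cofan.IsColimit.desc hF g),
      Cofan.IsColimit.hom_ext hF _ _ fun j => ?_⟩
    have : injF j ≫ Cofan.IsColimit.desc hF g = g j := Cofan.IsColimit.fac hF g j
    change injF j ≫ Cofan.IsColimit.desc hF g ≫ i = injF j ≫ hc.extendMap i
    rw [reassoc_of% this, hg]
  -- recursive coalgebras over `X`
  have ht (j : I) (hj : j ∈ S) : ∃ t : (A j).V ⟶ X, t.hom ≫ i = RecCoalg.leg c (A j) := by
    obtain ⟨t, ht⟩ := hmonotone (hmem hj) (hφA j)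
    exact ⟨ObjectProperty.homMk t, ht⟩
  obtain ⟨σ, hσ⟩ : ∃ σ : X ⟶ F.obj X, σ.hom ≫ hc.extendMap i = i := by
    have hj (j : I) (hj : j ∈ S) : ∃ g : Y j ⟶ (F.obj X).obj, g ≫ hc.extendMap i = inj j := by
      obtain ⟨t, ht⟩ := ht j hj
      obtain ⟨a, ha⟩ := hA j
      -- The component is lifted through a recursive coalgebra `A j` lying over `X`, whose structure
      -- leads into `F (A j)` and on to `F X`.
      refine ⟨a ≫ (A j).str.hom ≫ (F.map t).hom, ?_⟩
      rw [Category.assoc, Category.assoc, hc.map_extendMap, ht, hc.extendMap_leg,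
        RecCoalg.str_leg_next, ha]
    choose g hg using hj
    refine ⟨ObjectProperty.homMk (subSigma.desc g), subSigma.hom_ext fun j hj => ?_⟩
    change subSigma.inj Y hj ≫ subSigma.desc g ≫ hc.extendMap i = subSigma.inj Y hj ≫ ι S
    rw [subSigma.inj_desc_assoc, hg, hι]
  let e : F.obj X ≅ X :=
    { hom := x
      inv := σ
      hom_inv_id := ObjectProperty.hom_ext _ ((cancel_mono (hc.extendMap i)).1 (by
        change (x.hom ≫ σ.hom) ≫ _ = 𝟙 _ ≫ _
        rw [Category.assoc, hσ, hx, Category.id_comp]))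
      inv_hom_id := ObjectProperty.hom_ext _ ((cancel_mono i).1 (by
        change (σ.hom ≫ x.hom) ≫ i = 𝟙 _ ≫ i
        rw [Category.assoc, hx, hσ, Category.id_comp])) }
  refine hc.hasInitial_algebra e hx fun {Z f g} h => ObjectProperty.hom_ext _
    (subSigma.hom_ext fun j hj => ?_)
  obtain ⟨t, ht⟩ := ht j hj
  obtain ⟨a, ha⟩ := hA j
  have hat : a ≫ t.hom = subSigma.inj Y hj := (cancel_mono i).1 (by
    rw [Category.assoc, ht, ha]
    exact (hι hj).symm)
  have := congrArg (fun k => a ≫ k.hom) (h (A j) t ht)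
  rw [← hat, Category.assoc, Category.assoc]
  exact this

end

end StrictWidth

theorem theoremT (K : Type u) [Category.{v} K] (α : Cardinal.{v}) [Fact α.IsRegular]
    (hK : StrictWidth.IsStrictlyLocallyPresentable K α)
    (w : Cardinal.{v}) (hw : StrictWidth.HasStrictWidth K w)
    (lam : Cardinal.{v}) (hlam : max α w ≤ lam) :
    AlgebraicallyComplete (StrictWidth.PowerLE K lam) :=
  StrictWidth.algebraicallyComplete_powerLE hK hw ((le_max_left _ _).trans hlam)
    ((le_max_right _ _).trans hlam)
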